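/- Let $h$ be a known probability density on $\mathbb{R}$ (with respect to Lebesgue measure $\lambda$) of a noise variable $\varepsilon$ with $E\varepsilon=0$ and $0<E\varepsilon^2<\infty$. Let $\Theta\subseteq\mathbb{R}^k$ be an open set with $0\in\Theta$, and let $\{f_\theta\}_{\theta\in\Theta}$ be a family of probability densities on $\mathbb{R}$. Put $$q(y;\theta)=\int_{\mathbb{R}} f_\theta(s)\,h(y-s)\,ds ,$$ let $Q_\theta$ be the distribution with density $q(\cdot\,;\theta)$, and define the score function and the Fisher information matrix by $$\dot l(y;\theta)=\frac{\nabla_\theta\, q(y;\theta)}{q(y;\theta)}\,1_{[q(y;\theta)>0]},\qquad I(\theta)=\int_{\mathbb{R}}\dot l(y;\theta)\,\dot l(y;\theta)^T\,dQ_\theta(y).$$ Assume that the deconvolution problem is regular, that is: (B1) for $\lambda$-almost all $y$ the function $\theta\mapsto q(y;\theta)$ is continuously differentiable on $\Theta$; (B2) $|\dot l(\cdot\,;\theta)|\in L_2(Q_\theta)$ for all $\theta\in\Theta$; (B3) $I(\theta)$ is nonsingular for all $\theta\in\Theta$ and continuous in $\theta$. Then the following hold. (1) The efficient score vector for testing $H_0:\theta=0$,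 that is, $l^\ast(y)=\dot l(y;0)$ (the model has no nuisance parameter), is given by $$l^\ast(y)=\frac{\frac{\partial}{\partial\theta}\Bigl(\int_{\mathbb{R}} f_\theta(s)\,h(y-s)\,ds\Bigr)\Bigr|_{\theta=0}}{\int_{\mathbb{R}} f_0(s)\,h(y-s)\,ds},$$ where the right-hand side is read as $0$ when the denominator vanishes and the derivative exists for $\lambda$-almost all $y$. This function is the score at $\theta=0$ in the Hilbert space sense: $l^\ast\in L_2(Q_0)$, and $$\Bigl\|\sqrt{q(\cdot\,;\theta)}-\sqrt{q(\cdot\,;0)}-\tfrac12\langle\theta, l^\ast\rangle\sqrt{q(\cdot\,;0)}\Bigr\|_{L_2(\lambda)}=o(|\theta|)\quad\text{as }\theta\to0 .$$ (2) Let $Y_j=X_j+\varepsilon_j$, $j=1,2,\dots$, where all the $X_j,\varepsilon_j$ are independent, the $\varepsilon_j$ have density $h$, and (hypothesis $H_0$) the $X_j$ have density $f_0$. Treating $l^\ast$ as a row vector, put $$L=\bigl\{E_0\,[l^\ast(Y)]^T l^\ast(Y)\bigr\}^{-1},\qquad U_k=\Bigl\{\frac1{\sqrt n}\sum_{j=1}^n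 l^\ast(Y_j)\Bigr\}\,L\,\Bigl\{\frac1{\sqrt n}\sum_{j=1}^n l^\ast(Y_j)\Bigr\}^T,$$ where $E_0$ is the expectation for $Y\sim Q_0$. Then $U_k$ converges in distribution to $\chi^2_k$ as $n\to\infty$. -/

import Mathlib

open MeasureTheory ProbabilityTheory Filter Topology

noncomputable section

namespace Deconvolution

/-- `f` is a probability density on `ℝ` with respect to Lebesgue measure. -/
structure IsDensity (f : ℝ → ℝ) : Prop where
  measurable : Measurable f
  nonneg : ∀ x, 0 ≤ f x
  lintegral_eq_one : ∫⁻ x, ENNReal.ofReal (f x) = 1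

/-- `h` is the density of a centred noise variable `ε` with `0 < E ε² < ∞`. -/
structure IsNoiseDensity (h : ℝ → ℝ) : Prop where
  isDensity : IsDensity h
  integrable_sq : Integrable (fun x : ℝ => x ^ 2 * h x)
  mean_eq_zero : ∫ x : ℝ, x * h x = 0
  second_moment_pos : 0 < ∫ x : ℝ, x ^ 2 * h x

/-- The measure on `ℝ` with Lebesgue density `f`. -/
def densityMeasure (f : ℝ → ℝ) : Measure ℝ :=
  volume.withDensity (fun x => ENNReal.ofReal (f x))

variable {k : ℕ}

/-- The density `q(y; θ) = ∫ f_θ(s) h(y - s) ds` of `Y = X + ε`, when `X` has density `f_θ`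
and `ε` is independent of `X` with density `h`. -/
def q (f : EuclideanSpace ℝ (Fin k) → ℝ → ℝ) (h : ℝ → ℝ)
    (y : ℝ) (θ : EuclideanSpace ℝ (Fin k)) : ℝ :=
  ∫ s, f θ s * h (y - s)

/-- The law `Q_θ` with density `q(·; θ)`. -/
def Q (f : EuclideanSpace ℝ (Fin k) → ℝ → ℝ) (h : ℝ → ℝ)
    (θ : EuclideanSpace ℝ (Fin k)) : Measure ℝ :=
  densityMeasure (fun y => q f h y θ)

open Classical in
/-- The score function `l̇(y; θ) = (∇_θ q(y; θ) / q(y; θ)) 1_{q(y; θ) > 0}`. -/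
def score (f : EuclideanSpace ℝ (Fin k) → ℝ → ℝ) (h : ℝ → ℝ)
    (y : ℝ) (θ : EuclideanSpace ℝ (Fin k)) : EuclideanSpace ℝ (Fin k) :=
  if 0 < q f h y θ then (q f h y θ)⁻¹ • gradient (fun θ' => q f h y θ') θ else 0

/-- The Fisher information matrix `I(θ) = ∫ l̇(y; θ) l̇(y; θ)ᵀ dQ_θ(y)`. -/
def fisherInformation (f : EuclideanSpace ℝ (Fin k) → ℝ → ℝ) (h : ℝ → ℝ)
    (θ : EuclideanSpace ℝ (Fin k)) : Matrix (Fin k) (Fin k) ℝ :=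
  Matrix.of fun i j => ∫ y, score f h y θ i * score f h y θ j ∂(Q f h θ)

/-- A regular deconvolution problem with parameter set `Θ`, an open subset of `ℝ^k`. -/
structure IsRegular (Θ : Set (EuclideanSpace ℝ (Fin k)))
    (f : EuclideanSpace ℝ (Fin k) → ℝ → ℝ) (h : ℝ → ℝ) : Prop where
  isOpen : IsOpen Θ
  density : ∀ θ ∈ Θ, IsDensity (f θ)
  noise : IsNoiseDensity h
  /-- `q(y; ·)` is continuously differentiable on `Θ` for Lebesgue-almost all `y`. -/
  contDiff : ∀ᵐ y : ℝ, ContDiffOn ℝ 1 (fun θ => q f h y θ) Θ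
  /-- `|l̇(θ)| ∈ L₂(Q_θ)` for all `θ ∈ Θ`. -/
  memLp_score : ∀ θ ∈ Θ, MemLp (fun y => score f h y θ) 2 (Q f h θ)
  /-- `I(θ)` is nonsingular for all `θ ∈ Θ`. -/
  nonsingular : ∀ θ ∈ Θ, IsUnit (fisherInformation f h θ)
  /-- `I(θ)` is continuous in `θ`. -/
  continuous_information : ContinuousOn (fisherInformation f h) Θ

/-- `l` is the score at the parameter value `θ₀` in the Hilbert space sense: `l ∈ L₂(Q_{θ₀})`, and
`θ ↦ √q(·; θ) ∈ L₂(ℝ)` is Fréchet differentiable at `θ₀` with derivative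
`v ↦ ½ ⟨v, l⟩ √q(·; θ₀)`. -/
def IsQuadraticMeanScore (f : EuclideanSpace ℝ (Fin k) → ℝ → ℝ) (h : ℝ → ℝ)
    (θ₀ : EuclideanSpace ℝ (Fin k)) (l : ℝ → EuclideanSpace ℝ (Fin k)) : Prop :=
  MemLp l 2 (Q f h θ₀) ∧
  Tendsto (fun θ => eLpNorm (fun y => √(q f h y θ) - √(q f h y θ₀)
      - 1 / 2 * inner ℝ (θ - θ₀) (l y) * √(q f h y θ₀)) 2 volume / ‖θ - θ₀‖ₑ)
    (𝓝[≠] θ₀) (𝓝 0)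

/-- The efficient score vector `l*(y) = l̇(y; 0)` for testing `θ = 0`. There is no nuisance
parameter, so it is the score at `θ = 0`. -/
def efficientScore (f : EuclideanSpace ℝ (Fin k) → ℝ → ℝ) (h : ℝ → ℝ) (y : ℝ) :
    EuclideanSpace ℝ (Fin k) :=
  score f h y 0

/-- `L = {E₀ [l*(Y)]ᵀ l*(Y)}⁻¹` (with `l*` as a row vector), `E₀` the expectation for `Y ∼ Q_0`. -/
def L (f : EuclideanSpace ℝ (Fin k) → ℝ → ℝ) (h : ℝ → ℝ) : Matrix (Fin k) (Fin k) ℝ :=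
  (Matrix.of fun i j => ∫ y, efficientScore f h y i * efficientScore f h y j ∂(Q f h 0))⁻¹

/-- The normalized score sum `n^{-1/2} ∑_{j ≤ n} l*(Y_j)`; the observations are indexed from `0`. -/
def scoreSum (f : EuclideanSpace ℝ (Fin k) → ℝ → ℝ) (h : ℝ → ℝ) (n : ℕ) (Y : ℕ → ℝ) :
    EuclideanSpace ℝ (Fin k) :=
  (1 / √(n : ℝ)) • ∑ j ∈ Finset.range n, efficientScore f h (Y j)

/-- The score test statistic `U_k` computed from the first `n` observations. -/
def U (f : EuclideanSpace ℝ (Fin k) → ℝ → ℝ) (h : ℝ → ℝ) (n : ℕ) (Y : ℕ → ℝ) : ℝ :=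
  ∑ i, ∑ j, scoreSum f h n Y i * L f h i j * scoreSum f h n Y j

/-- The chi-square distribution with `k` degrees of freedom: the law of the sum of the squares of
`k` independent standard normal variables. -/
def chiSquare (k : ℕ) : Measure ℝ :=
  (Measure.pi (fun _ : Fin k => gaussianReal 0 1)).map (fun z => ∑ i, z i ^ 2)

instance (k : ℕ) : IsProbabilityMeasure (chiSquare k) :=
  Measure.isProbabilityMeasure_map
    (Finset.measurable_sum _ fun i _ => (measurable_pi_apply i).pow_const 2).aemeasurable

/-- The signals `X i` are i.i.d. with density `f₀`, the noises `ε i` are i.i.d. with density `h`,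
and all these variables are jointly independent. -/
structure IsSample {Ω : Type*} [MeasurableSpace Ω] (P : Measure Ω) (f₀ h : ℝ → ℝ)
    (X ε : ℕ → Ω → ℝ) : Prop where
  law_signal : ∀ i, HasLaw (X i) (densityMeasure f₀) P
  law_noise : ∀ i, HasLaw (ε i) (densityMeasure h) P
  indep_signal_noise : ∀ i, IndepFun (X i) (ε i) P
  indep : iIndepFun (fun i ω => (X i ω, ε i ω)) P

end Deconvolution

end

/-
The map `θ ↦ √q(·; θ)` is Fréchet differentiable into `L²`. Pointwise, `|√q(y; θ) - √q(y; θ₀)|²` is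
at most the average over the segment from `θ₀` to `θ` of the squared derivatives of `√q(y; ·)` in
the direction `θ - θ₀`. Integrating in `y`, the squared `L²` norm of the increment is at most the
average of `¼ ⟨v, I(·) v⟩`, `v = θ - θ₀`, which by continuity of `I` is `¼ ⟨v, I(θ₀) v⟩ + o(|v|²)`.
Hence the `L²` norms of the difference quotients do not exceed, in the limit, that of the pointwise
derivative, and pointwise convergence without excess mass is `L²` convergence.

Since `‖√q(·; θ)‖ = 1` for all `θ`, the derivative is orthogonal to `√q(·; θ₀)`, that is, the score
has mean zero. The central limit theorem gives the limit `N(0, I(0))` of the normalized score sum,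
and the quadratic form of `I(0)⁻¹` maps this law to `χ²`.
-/

namespace Deconvolution

section Increment

open scoped unitInterval ENNReal

variable {E : Type*} [NormedAddCommGroup E] [NormedSpace ℝ E]

theorem sq_eLpNorm_two_eq_lintegral {α ε : Type*} [MeasurableSpace α] {μ : Measure α}
    [TopologicalSpace ε] [ContinuousENorm ε] (F : α → ε) :
    eLpNorm F 2 μ ^ 2 = ∫⁻ x, ‖F x‖ₑ ^ 2 ∂μ := by
  simpa using eLpNorm_nnreal_pow_eq_lintegral (f := F) (μ := μ) (p := 2) two_ne_zero

theorem sq_lintegral_le_lintegral_sq {α : Type*} [MeasurableSpace α] {μ : Measure α}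
    [IsProbabilityMeasure μ] {F : α → ℝ≥0∞} (hF : AEMeasurable F μ) :
    (∫⁻ x, F x ∂μ) ^ 2 ≤ ∫⁻ x, F x ^ 2 ∂μ := by
  have hnorm := eLpNorm_le_eLpNorm_of_exponent_le (p := 1) (q := 2) one_le_two
    hF.aestronglyMeasurable
  rw [eLpNorm_one_eq_lintegral_enorm] at hnorm
  exact (pow_le_pow_left' hnorm 2).trans_eq (sq_eLpNorm_two_eq_lintegral F)

-- At a zero of `g`, `√g` is minimal, so its derivative there is `0`, whether or not it exists.
theorem fderiv_sqrt_eq_smul {g : E → ℝ} {θ : E} (hg : DifferentiableAt ℝ g θ) :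
    fderiv ℝ (fun x => √(g x)) θ = (2 * √(g θ))⁻¹ • fderiv ℝ g θ := by
  rcases eq_or_ne (√(g θ)) 0 with hzero | hzero
  · have hmin : IsLocalMin (fun x => √(g x)) θ :=
      Eventually.of_forall fun x => hzero.trans_le (Real.sqrt_nonneg _)
    rw [hmin.fderiv_eq_zero, hzero, mul_zero, inv_zero, zero_smul]
  · rw [fderiv_sqrt hg fun h => hzero (by rw [h, Real.sqrt_zero]), one_div]

variable {Θ : Set E}

theorem enorm_fderiv_sqrt_add_le (hΘ : IsOpen Θ) {g : E → ℝ} (hg : DifferentiableOn ℝ g Θ)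
    (hnonneg : ∀ θ ∈ Θ, 0 ≤ g θ) {θ : E} (hθ : θ ∈ Θ) (v : E) {δ : ℝ} (hδ : 0 < δ) :
    ‖fderiv ℝ (fun x => √(g x + δ)) θ v‖ₑ ≤ ‖fderiv ℝ (fun x => √(g x)) θ v‖ₑ := by
  have hdiff := hg.differentiableAt (hΘ.mem_nhds hθ)
  rw [fderiv_sqrt_eq_smul (hdiff.add_const δ), fderiv_sqrt_eq_smul hdiff, fderiv_add_const,
    enorm_le_iff_norm_le, smul_apply, smul_apply, norm_smul, norm_smul]
  rcases (hnonneg θ hθ).eq_or_lt with hzero | hpos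
  · have hmin : IsLocalMin g θ := by
      filter_upwards [hΘ.mem_nhds hθ] with x hx using hzero ▸ hnonneg x hx
    simp [hmin.fderiv_eq_zero]
  · have := Real.sqrt_pos.2 hpos
    refine mul_le_mul_of_nonneg_right (abs_le_abs_of_nonneg (by positivity) ?_) (norm_nonneg _)
    gcongr
    exact le_add_of_nonneg_right hδ.le

theorem enorm_sub_le_lintegral_fderiv_segment {F : Type*} [NormedAddCommGroup F] [NormedSpace ℝ F]
    (hΘ : IsOpen Θ) {u : E → F} (hu : ContDiffOn ℝ 1 u Θ) {a b : E} (hab : segment ℝ a b ⊆ Θ) :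
    ‖u b - u a‖ₑ ≤ ∫⁻ t : I, ‖fderiv ℝ u (AffineMap.lineMap a b (t : ℝ)) (b - a)‖ₑ := by
  have hmem : Set.MapsTo (AffineMap.lineMap a b : ℝ → E) (Set.Icc 0 1) Θ := fun t ht =>
    hab (segment_eq_image_lineMap ℝ a b ▸ Set.mem_image_of_mem _ ht)
  have hcont : ContDiffOn ℝ 1 (u ∘ AffineMap.lineMap a b) (Set.Icc (0 : ℝ) 1) :=
    hu.comp (AffineMap.contDiff_lineMap a b).contDiffOn hmem
  have hderiv (t : ℝ) (ht : t ∈ Set.Icc (0 : ℝ) 1) : deriv (u ∘ AffineMap.lineMap a b) t =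
      fderiv ℝ u (AffineMap.lineMap a b t) (b - a) :=
    (((hu.differentiableOn one_ne_zero).differentiableAt
      (hΘ.mem_nhds (hmem ht))).hasFDerivAt.comp_hasDerivAt t AffineMap.hasDerivAt_lineMap).deriv
  calc ‖u b - u a‖ₑ
      ≤ ∫⁻ t in Set.Icc (0 : ℝ) 1, ‖deriv (u ∘ AffineMap.lineMap a b) t‖ₑ := by
        simpa using enorm_sub_le_lintegral_deriv_of_contDiffOn_Icc hcont zero_le_one
    _ = ∫⁻ t in Set.Icc (0 : ℝ) 1, ‖fderiv ℝ u (AffineMap.lineMap a b t) (b - a)‖ₑ :=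
        setLIntegral_congr_fun measurableSet_Icc fun t ht => by rw [hderiv t ht]
    _ = _ := (lintegral_subtype_comap measurableSet_Icc _).symm

theorem enorm_sqrt_sub_le_lintegral_fderiv (hΘ : IsOpen Θ) {g : E → ℝ} (hg : ContDiffOn ℝ 1 g Θ)
    (hnonneg : ∀ θ ∈ Θ, 0 ≤ g θ) {a b : E} (hab : segment ℝ a b ⊆ Θ) :
    ‖√(g b) - √(g a)‖ₑ ≤
      ∫⁻ t : I, ‖fderiv ℝ (fun x => √(g x)) (AffineMap.lineMap a b (t : ℝ)) (b - a)‖ₑ := by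
  have hlim : Tendsto (fun δ => ‖√(g b + δ) - √(g a + δ)‖ₑ) (𝓝[>] 0)
      (𝓝 ‖√(g b) - √(g a)‖ₑ) := by
    have hcont : Continuous fun δ => ‖√(g b + δ) - √(g a + δ)‖ₑ := by fun_prop
    simpa using (hcont.tendsto 0).mono_left nhdsWithin_le_nhds
  refine le_of_tendsto hlim ?_
  filter_upwards [self_mem_nhdsWithin] with δ hδ
  have hpos (θ : E) (hθ : θ ∈ Θ) : g θ + δ ≠ 0 :=
    (add_pos_of_nonneg_of_pos (hnonneg θ hθ) hδ).ne'
  refine (enorm_sub_le_lintegral_fderiv_segment hΘ ((hg.add contDiffOn_const).sqrt hpos)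
    hab).trans (lintegral_mono fun t => ?_)
  exact enorm_fderiv_sqrt_add_le hΘ (hg.differentiableOn one_ne_zero) hnonneg
    (hab (segment_eq_image_lineMap ℝ a b ▸ Set.mem_image_of_mem _ t.2)) _ hδ

end Increment

section C1Family

open scoped unitInterval ENNReal

variable {α : Type*} [MeasurableSpace α] {μ : Measure α}
  {E : Type*} [NormedAddCommGroup E] [NormedSpace ℝ E] {Θ : Set E} {p : α → E → ℝ} {θ : E}

/-- A family of nonnegative measurable functions `p · θ` on `α`, with `θ` in an open set `Θ`, such
that `p y` is continuously differentiable on `Θ` for `μ`-almost all `y`. -/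
structure IsC1Family (μ : Measure α) (Θ : Set E) (p : α → E → ℝ) : Prop where
  isOpen : IsOpen Θ
  measurable : ∀ θ ∈ Θ, Measurable fun y => p y θ
  nonneg : ∀ y, ∀ θ ∈ Θ, 0 ≤ p y θ
  contDiffOn : ∀ᵐ y ∂μ, ContDiffOn ℝ 1 (p y) Θ

theorem IsC1Family.ae_differentiableAt (hp : IsC1Family μ Θ p) (hθ : θ ∈ Θ) :
    ∀ᵐ y ∂μ, DifferentiableAt ℝ (p y) θ := by
  filter_upwards [hp.contDiffOn] with y hy
  exact (hy.differentiableOn one_ne_zero).differentiableAt (hp.isOpen.mem_nhds hθ)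

theorem measurable_fderiv_apply_of_differentiableAt (hΘ : Θ ∈ 𝓝 θ)
    (hmeas : ∀ θ' ∈ Θ, Measurable fun y => p y θ') (hdiff : ∀ y, DifferentiableAt ℝ (p y) θ)
    (v : E) : Measurable fun y => fderiv ℝ (p y) θ v := by
  have hscale : Tendsto (fun n : ℕ => (n : ℝ) + 1) atTop atTop :=
    tendsto_natCast_atTop_atTop.atTop_add tendsto_const_nhds
  have hpoint : Tendsto (fun n : ℕ => θ + ((n : ℝ) + 1)⁻¹ • v) atTop (𝓝 θ) := by
    simpa using (hscale.inv_tendsto_atTop.smul_const v).const_add θ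
  obtain ⟨N, hN⟩ := eventually_atTop.1 (hpoint.eventually hΘ)
  refine measurable_of_tendsto_metrizable
    (f := fun n y => (((n + N : ℕ) : ℝ) + 1) •
      (p y (θ + (((n + N : ℕ) : ℝ) + 1)⁻¹ • v) - p y θ)) (fun n => ?_) ?_
  · simp only [smul_eq_mul]
    exact ((hmeas _ (hN _ (Nat.le_add_left _ _))).sub (hmeas _ (mem_of_mem_nhds hΘ))).const_mul _
  · refine tendsto_pi_nhds.2 fun y => ?_
    exact ((hdiff y).hasFDerivAt.lim_real v).comp (hscale.comp (tendsto_add_atTop_nat N))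

theorem measurable_uncurry_fderiv_sqrt_segment (hΘ : IsOpen Θ)
    (hmeas : ∀ θ ∈ Θ, Measurable fun y => p y θ) (hC1 : ∀ y, ContDiffOn ℝ 1 (p y) Θ)
    {a b : E} (hab : segment ℝ a b ⊆ Θ) :
    Measurable fun z : α × I =>
      fderiv ℝ (fun x => √(p z.1 x)) (AffineMap.lineMap a b (z.2 : ℝ)) (b - a) := by
  have hmem (t : I) : AffineMap.lineMap a b (t : ℝ) ∈ Θ :=
    hab (segment_eq_image_lineMap ℝ a b ▸ Set.mem_image_of_mem _ t.2)
  have hline : Continuous fun t : I => (AffineMap.lineMap a b (t : ℝ) : E) :=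
    AffineMap.lineMap_continuous.comp continuous_subtype_val
  have hdiff (y : α) (t : I) : DifferentiableAt ℝ (p y) (AffineMap.lineMap a b (t : ℝ)) :=
    ((hC1 y).differentiableOn one_ne_zero).differentiableAt (hΘ.mem_nhds (hmem t))
  have hvalue : Measurable (Function.uncurry fun (t : I) y =>
      p y (AffineMap.lineMap a b (t : ℝ))) :=
    measurable_uncurry_of_continuous_of_measurable
      (fun y => (hC1 y).continuousOn.comp_continuous hline hmem) fun t => hmeas _ (hmem t)
  have hderiv : Measurable (Function.uncurry fun (t : I) y =>
      fderiv ℝ (p y) (AffineMap.lineMap a b (t : ℝ)) (b - a)) :=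
    measurable_uncurry_of_continuous_of_measurable
      (fun y => (((hC1 y).continuousOn_fderiv_of_isOpen hΘ le_rfl).comp_continuous hline
        hmem).clm_apply continuous_const)
      fun t => measurable_fderiv_apply_of_differentiableAt (hΘ.mem_nhds (hmem t)) hmeas
        (fun y => hdiff y t) _
  simp only [fderiv_sqrt_eq_smul (hdiff _ _)]
  exact ((((hvalue.comp measurable_swap).sqrt.const_mul 2).inv).smul
    (hderiv.comp measurable_swap))

theorem lintegral_sqrt_sub_sq_le_of_forall [SFinite μ] (hΘ : IsOpen Θ)
    (hmeas : ∀ θ ∈ Θ, Measurable fun y => p y θ) (hnonneg : ∀ y, ∀ θ ∈ Θ, 0 ≤ p y θ)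
    (hC1 : ∀ y, ContDiffOn ℝ 1 (p y) Θ) {a b : E} (hab : segment ℝ a b ⊆ Θ) {C : ℝ≥0∞}
    (hC : ∀ θ ∈ segment ℝ a b,
      ∫⁻ y, ‖fderiv ℝ (fun x => √(p y x)) θ (b - a)‖ₑ ^ 2 ∂μ ≤ C) :
    ∫⁻ y, ‖√(p y b) - √(p y a)‖ₑ ^ 2 ∂μ ≤ C := by
  have hjoint := (measurable_uncurry_fderiv_sqrt_segment hΘ hmeas hC1 hab).enorm
  calc ∫⁻ y, ‖√(p y b) - √(p y a)‖ₑ ^ 2 ∂μ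
      ≤ ∫⁻ y, (∫⁻ t : I, ‖fderiv ℝ (fun x => √(p y x))
          (AffineMap.lineMap a b (t : ℝ)) (b - a)‖ₑ) ^ 2 ∂μ := by
        gcongr with y
        exact enorm_sqrt_sub_le_lintegral_fderiv hΘ (hC1 y) (hnonneg y) hab
    _ ≤ ∫⁻ y, (∫⁻ t : I, ‖fderiv ℝ (fun x => √(p y x))
          (AffineMap.lineMap a b (t : ℝ)) (b - a)‖ₑ ^ 2) ∂μ :=
        lintegral_mono fun y => sq_lintegral_le_lintegral_sq
          (hjoint.comp measurable_prodMk_left).aemeasurable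
    _ = ∫⁻ t : I, ∫⁻ y, ‖fderiv ℝ (fun x => √(p y x))
          (AffineMap.lineMap a b (t : ℝ)) (b - a)‖ₑ ^ 2 ∂μ :=
        lintegral_lintegral_swap (hjoint.pow_const 2).aemeasurable
    _ ≤ ∫⁻ _ : I, C :=
        lintegral_mono fun t =>
          hC _ (segment_eq_image_lineMap ℝ a b ▸ Set.mem_image_of_mem _ t.2)
    _ = C := by simp

theorem IsC1Family.lintegral_sqrt_sub_sq_le [SFinite μ] (hp : IsC1Family μ Θ p)
    {a b : E} (hab : segment ℝ a b ⊆ Θ) {C : ℝ≥0∞}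
    (hC : ∀ θ ∈ segment ℝ a b,
      ∫⁻ y, ‖fderiv ℝ (fun x => √(p y x)) θ (b - a)‖ₑ ^ 2 ∂μ ≤ C) :
    ∫⁻ y, ‖√(p y b) - √(p y a)‖ₑ ^ 2 ∂μ ≤ C := by
  classical
  obtain ⟨N, hN, hNmeas, hNC1⟩ := hp.contDiffOn.exists_measurable_mem
  set p' : α → E → ℝ := fun y θ => if y ∈ N then p y θ else 0
  have hp' (y : α) (hy : y ∈ N) : p' y = p y := funext fun θ => if_pos hy
  calc ∫⁻ y, ‖√(p y b) - √(p y a)‖ₑ ^ 2 ∂μ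
      = ∫⁻ y, ‖√(p' y b) - √(p' y a)‖ₑ ^ 2 ∂μ :=
        lintegral_congr_ae (by filter_upwards [hN] with y hy using by rw [hp' y hy])
    _ ≤ C := by
        refine lintegral_sqrt_sub_sq_le_of_forall (p := p') hp.isOpen
          (fun θ hθ => (hp.measurable θ hθ).ite hNmeas measurable_const)
          (fun y θ hθ => ?_) (fun y => ?_) hab fun θ hθ => ?_
        · by_cases hy : y ∈ N
          · exact hp' y hy ▸ hp.nonneg y θ hθ
          · simp only [p', if_neg hy, le_rfl]
        · by_cases hy : y ∈ N
          · exact hp' y hy ▸ hNC1 y hy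
          · simpa only [p', if_neg hy] using contDiffOn_const
        · refine (lintegral_congr_ae ?_).trans_le (hC θ hθ)
          filter_upwards [hN] with y hy using by rw [hp' y hy]

end C1Family

section QuadraticMean

open scoped ENNReal

variable {α : Type*} [MeasurableSpace α] {μ : Measure α}

theorem tendsto_lintegral_min_norm_mul {ι : Type*} {l : Filter ι} [l.IsCountablyGenerated]
    {F : Type*} [NormedAddCommGroup F] {W : ι → α → F} {G : α → ℝ}
    (hW : ∀ᶠ i in l, AEStronglyMeasurable (W i) μ) (hG : MemLp G 2 μ)
    (hlim : ∀ᵐ y ∂μ, G y ≠ 0 → Tendsto (fun i => W i y) l (𝓝 0)) :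
    Tendsto (fun i => ∫⁻ y, ENNReal.ofReal (min (4 * (G y * ‖W i y‖)) (4 * G y ^ 2)) ∂μ) l
      (𝓝 0) := by
  rw [← lintegral_zero (μ := μ)]
  refine tendsto_lintegral_filter_of_dominated_convergence'
    (fun y => ENNReal.ofReal (4 * G y ^ 2)) ?_ ?_ ?_ ?_
  · filter_upwards [hW] with i hi
    have hGmeas := hG.1.aemeasurable
    exact (((hGmeas.mul hi.norm.aemeasurable).const_mul 4).min
      ((hGmeas.pow_const 2).const_mul 4)).ennreal_ofReal
  · exact Eventually.of_forall fun i => ae_of_all _ fun y =>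
      ENNReal.ofReal_le_ofReal (min_le_right _ _)
  · exact (hG.integrable_sq.const_mul 4).lintegral_lt_top.ne
  · filter_upwards [hlim] with y hy
    by_cases hGy : G y = 0
    · simpa [hGy] using tendsto_const_nhds
    · have hmul : Tendsto (fun i => 4 * (G y * ‖W i y‖)) l (𝓝 0) := by
        simpa using ((hy hGy).norm.const_mul (G y)).const_mul 4
      have hmin := hmul.min (tendsto_const_nhds (x := 4 * G y ^ 2))
      rw [min_eq_left (by positivity)] at hmin
      simpa using ENNReal.tendsto_ofReal hmin

section HilbertValued

variable {F : Type*} [NormedAddCommGroup F] [InnerProductSpace ℝ F]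

-- The excess `‖z - v‖² + 2‖v‖² - 2‖z‖²` equals `-4⟪v, z - v⟫ - ‖z - v‖²`, small when `z - v` is
-- small and at most `4‖v‖²` always: this is what dominated convergence needs.
theorem norm_sub_sq_add_le_of_norm_le {z v : F} {g : ℝ} (hv : ‖v‖ ≤ g) :
    ‖z - v‖ ^ 2 + 2 * ‖v‖ ^ 2 ≤
      2 * ‖z‖ ^ 2 + min (4 * (g * ‖z - v‖)) (4 * g ^ 2) := by
  have hexpand : ‖z‖ ^ 2 = ‖v‖ ^ 2 + 2 * inner ℝ v (z - v) + ‖z - v‖ ^ 2 := by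
    rw [← norm_add_sq_real, add_sub_cancel]
  have hinner : -(g * ‖z - v‖) ≤ inner ℝ v (z - v) :=
    (neg_le_neg (mul_le_mul_of_nonneg_right hv (norm_nonneg _))).trans
      (neg_le_of_abs_le (abs_real_inner_le_norm _ _))
  rw [add_comm (2 * ‖z‖ ^ 2), ← sub_le_iff_le_add]
  refine le_min ?_ ?_ <;> nlinarith [sq_nonneg (2 * g - ‖z - v‖), sq_nonneg ‖z - v‖]

theorem enorm_sub_sq_add_le_of_norm_le {z v : F} {g : ℝ} (hv : ‖v‖ ≤ g) :
    ‖z - v‖ₑ ^ 2 + 2 * ‖v‖ₑ ^ 2 ≤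
      2 * ‖z‖ₑ ^ 2 + ENNReal.ofReal (min (4 * (g * ‖z - v‖)) (4 * g ^ 2)) := by
  have hg : 0 ≤ g := (norm_nonneg v).trans hv
  have henorm (x : F) : ‖x‖ₑ ^ 2 = ENNReal.ofReal (‖x‖ ^ 2) := by
    rw [← ofReal_norm, ENNReal.ofReal_pow (norm_nonneg x)]
  have htwo (r : ℝ) : 2 * ENNReal.ofReal r = ENNReal.ofReal (2 * r) := by
    rw [ENNReal.ofReal_mul two_pos.le, ENNReal.ofReal_ofNat]
  rw [henorm, henorm, henorm, htwo, htwo, ← ENNReal.ofReal_add (by positivity) (by positivity),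
    ← ENNReal.ofReal_add (by positivity) (by positivity)]
  exact ENNReal.ofReal_le_ofReal (norm_sub_sq_add_le_of_norm_le hv)

theorem tendsto_eLpNorm_sub_of_lintegral_sq_le {ι : Type*} {l : Filter ι}
    [l.IsCountablyGenerated] {Z V : ι → α → F} {G : α → ℝ}
    (hZ : ∀ᶠ i in l, AEStronglyMeasurable (Z i) μ) (hV : ∀ᶠ i in l, AEStronglyMeasurable (V i) μ)
    (hG : MemLp G 2 μ) (hVG : ∀ i y, ‖V i y‖ ≤ G y)
    (hlim : ∀ᵐ y ∂μ, G y ≠ 0 → Tendsto (fun i => Z i y - V i y) l (𝓝 0))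
    (hle : ∀ ε > 0, ∀ᶠ i in l, ∫⁻ y, ‖Z i y‖ₑ ^ 2 ∂μ ≤ ∫⁻ y, ‖V i y‖ₑ ^ 2 ∂μ + ε) :
    Tendsto (fun i => eLpNorm (Z i - V i) 2 μ) l (𝓝 0) := by
  set R : ι → ℝ≥0∞ := fun i =>
    ∫⁻ y, ENNReal.ofReal (min (4 * (G y * ‖Z i y - V i y‖)) (4 * G y ^ 2)) ∂μ
  have hR : Tendsto R l (𝓝 0) :=
    tendsto_lintegral_min_norm_mul ((hZ.and hV).mono fun i hi => hi.1.sub hi.2) hG hlim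
  have hVfin (i : ι) : ∫⁻ y, ‖V i y‖ₑ ^ 2 ∂μ ≠ ∞ := by
    refine ((lintegral_mono fun y => ?_).trans_lt hG.integrable_sq.lintegral_lt_top).ne
    rw [← ofReal_norm, ← ENNReal.ofReal_pow (norm_nonneg _)]
    exact ENNReal.ofReal_le_ofReal (pow_le_pow_left₀ (norm_nonneg _) (hVG i y) 2)
  suffices hsq : Tendsto (fun i => eLpNorm (Z i - V i) 2 μ ^ 2) l (𝓝 0) by
    simpa [← ENNReal.rpow_natCast_mul] using hsq.ennrpow_const (1 / 2)
  refine ENNReal.tendsto_nhds_zero.2 fun ε hε => ?_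
  filter_upwards [hZ, hle (ε / 2 / 2) (ENNReal.half_pos (ENNReal.half_pos hε.ne').ne'),
    ENNReal.tendsto_nhds_zero.1 hR (ε / 2) (ENNReal.half_pos hε.ne')] with i hZi hlei hRi
  have hcancel : ∫⁻ y, ‖Z i y - V i y‖ₑ ^ 2 ∂μ + 2 * ∫⁻ y, ‖V i y‖ₑ ^ 2 ∂μ ≤
      ε + 2 * ∫⁻ y, ‖V i y‖ₑ ^ 2 ∂μ := by
    calc ∫⁻ y, ‖Z i y - V i y‖ₑ ^ 2 ∂μ + 2 * ∫⁻ y, ‖V i y‖ₑ ^ 2 ∂μ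
        = ∫⁻ y, ‖Z i y - V i y‖ₑ ^ 2 ∂μ + ∫⁻ y, 2 * ‖V i y‖ₑ ^ 2 ∂μ := by
          rw [lintegral_const_mul' _ _ ENNReal.ofNat_ne_top]
      _ ≤ ∫⁻ y, (‖Z i y - V i y‖ₑ ^ 2 + 2 * ‖V i y‖ₑ ^ 2) ∂μ := le_lintegral_add _ _
      _ ≤ ∫⁻ y, (2 * ‖Z i y‖ₑ ^ 2 +
            ENNReal.ofReal (min (4 * (G y * ‖Z i y - V i y‖)) (4 * G y ^ 2))) ∂μ :=
          lintegral_mono fun y => enorm_sub_sq_add_le_of_norm_le (hVG i y)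
      _ = 2 * ∫⁻ y, ‖Z i y‖ₑ ^ 2 ∂μ + R i := by
          rw [lintegral_add_left' ((hZi.enorm.pow_const 2).const_mul 2),
            lintegral_const_mul' _ _ ENNReal.ofNat_ne_top]
      _ ≤ 2 * (∫⁻ y, ‖V i y‖ₑ ^ 2 ∂μ + ε / 2 / 2) + ε / 2 := by gcongr
      _ = ε + 2 * ∫⁻ y, ‖V i y‖ₑ ^ 2 ∂μ := by
          rw [mul_add, ENNReal.mul_div_cancel two_ne_zero ENNReal.ofNat_ne_top, add_assoc,
            ENNReal.add_halves, add_comm]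
  exact (sq_eLpNorm_two_eq_lintegral _).trans_le
    (ENNReal.le_of_add_le_add_right (ENNReal.mul_ne_top (by simp) (hVfin i)) hcancel)

end HilbertValued

variable {E : Type*} [NormedAddCommGroup E] [NormedSpace ℝ E] {Θ : Set E} {p : α → E → ℝ}
  {θ₀ : E}

theorem norm_clm_apply_inv_norm_smul_le (T : E →L[ℝ] ℝ) (v : E) : ‖T (‖v‖⁻¹ • v)‖ ≤ ‖T‖ := by
  refine (T.le_opNorm _).trans (mul_le_of_le_one_right (norm_nonneg _) ?_)
  rw [norm_smul, norm_inv, norm_norm]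
  exact inv_mul_le_one

theorem tendsto_inv_norm_smul_sub_sub_fderiv {g : E → ℝ} (hg : fderiv ℝ g θ₀ ≠ 0) :
    Tendsto (fun θ => ‖θ - θ₀‖⁻¹ • (g θ - g θ₀) - fderiv ℝ g θ₀ (‖θ - θ₀‖⁻¹ • (θ - θ₀)))
      (𝓝[≠] θ₀) (𝓝 0) := by
  have hdiff : DifferentiableAt ℝ g θ₀ := by
    by_contra h
    exact hg (fderiv_zero_of_not_differentiableAt h)
  refine squeeze_zero_norm' (Eventually.of_forall fun θ => le_of_eq ?_)
    ((hasFDerivAt_iff_tendsto.1 hdiff.hasFDerivAt).mono_left nhdsWithin_le_nhds)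
  rw [map_smul, ← smul_sub, norm_smul, norm_inv, norm_norm]

theorem IsC1Family.eventually_lintegral_smul_sub_sq_le [SFinite μ] (hp : IsC1Family μ Θ p)
    (hθ₀ : θ₀ ∈ Θ) {ε : ℝ≥0∞}
    (hle : ∀ᶠ θ in 𝓝 θ₀, ∀ v, ∫⁻ y, ‖fderiv ℝ (fun x => √(p y x)) θ v‖ₑ ^ 2 ∂μ ≤
      ∫⁻ y, ‖fderiv ℝ (fun x => √(p y x)) θ₀ v‖ₑ ^ 2 ∂μ + ε * ‖v‖ₑ ^ 2) :
    ∀ᶠ θ in 𝓝[≠] θ₀, ∫⁻ y, ‖‖θ - θ₀‖⁻¹ • (√(p y θ) - √(p y θ₀))‖ₑ ^ 2 ∂μ ≤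
      ∫⁻ y, ‖fderiv ℝ (fun x => √(p y x)) θ₀ (‖θ - θ₀‖⁻¹ • (θ - θ₀))‖ₑ ^ 2 ∂μ + ε := by
  obtain ⟨r, hr, hball⟩ := Metric.eventually_nhds_iff_ball.1
    (hle.and (hp.isOpen.eventually_mem hθ₀))
  filter_upwards [nhdsWithin_le_nhds (Metric.ball_mem_nhds θ₀ hr), self_mem_nhdsWithin]
    with θ hθ hne
  have hseg : segment ℝ θ₀ θ ⊆ Metric.ball θ₀ r :=
    (convex_ball θ₀ r).segment_subset (Metric.mem_ball_self hr) hθ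
  have hincrement := hp.lintegral_sqrt_sub_sq_le (fun x hx => (hball x (hseg hx)).2)
    fun x hx => (hball x (hseg hx)).1 (θ - θ₀)
  have hsub : θ - θ₀ ≠ 0 := sub_ne_zero.2 hne
  have hnorm : ‖‖θ - θ₀‖⁻¹‖ₑ ^ 2 * ‖θ - θ₀‖ₑ ^ 2 = 1 := by
    rw [← mul_pow, enorm_inv (norm_ne_zero_iff.2 hsub), enorm_norm,
      ENNReal.inv_mul_cancel (enorm_ne_zero.2 hsub) enorm_ne_top, one_pow]
  simp only [map_smul, enorm_smul, mul_pow]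
  rw [lintegral_const_mul' _ _ (by finiteness), lintegral_const_mul' _ _ (by finiteness)]
  refine (mul_le_mul_right hincrement _).trans_eq ?_
  rw [mul_add, mul_left_comm, hnorm, mul_one]

theorem IsC1Family.tendsto_eLpNorm_sqrt_sub_sub_fderiv [SFinite μ] (hp : IsC1Family μ Θ p)
    (hθ₀ : θ₀ ∈ Θ) (hmemLp : MemLp (fun y => fderiv ℝ (fun x => √(p y x)) θ₀) 2 μ)
    (hle : ∀ ε > 0, ∀ᶠ θ in 𝓝 θ₀, ∀ v, ∫⁻ y, ‖fderiv ℝ (fun x => √(p y x)) θ v‖ₑ ^ 2 ∂μ ≤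
      ∫⁻ y, ‖fderiv ℝ (fun x => √(p y x)) θ₀ v‖ₑ ^ 2 ∂μ + ε * ‖v‖ₑ ^ 2) :
    Tendsto (fun θ => eLpNorm (fun y => √(p y θ) - √(p y θ₀) -
      fderiv ℝ (fun x => √(p y x)) θ₀ (θ - θ₀)) 2 μ / ‖θ - θ₀‖ₑ) (𝓝[≠] θ₀) (𝓝 0) := by
  have hmem : ∀ᶠ θ in 𝓝[≠] θ₀, θ ∈ Θ := nhdsWithin_le_nhds (hp.isOpen.mem_nhds hθ₀)
  have happly (v : E) : AEStronglyMeasurable (fun y => fderiv ℝ (fun x => √(p y x)) θ₀ v) μ :=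
    (ContinuousLinearMap.apply ℝ ℝ v).continuous.comp_aestronglyMeasurable hmemLp.1
  have hlim := tendsto_eLpNorm_sub_of_lintegral_sq_le (l := 𝓝[≠] θ₀)
    (Z := fun θ y => ‖θ - θ₀‖⁻¹ • (√(p y θ) - √(p y θ₀)))
    (V := fun θ y => fderiv ℝ (fun x => √(p y x)) θ₀ (‖θ - θ₀‖⁻¹ • (θ - θ₀)))
    (hmem.mono fun θ hθ => (((hp.measurable θ hθ).sqrt.sub
      (hp.measurable θ₀ hθ₀).sqrt).const_smul ‖θ - θ₀‖⁻¹).aestronglyMeasurable)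
    (Eventually.of_forall fun θ => happly _) hmemLp.norm
    (fun θ y => norm_clm_apply_inv_norm_smul_le _ _)
    (ae_of_all _ fun y hy => tendsto_inv_norm_smul_sub_sub_fderiv (norm_ne_zero_iff.1 hy))
    fun ε hε => hp.eventually_lintegral_smul_sub_sq_le hθ₀ (hle ε hε)
  refine hlim.congr' ?_
  filter_upwards [self_mem_nhdsWithin] with θ hne
  rw [div_eq_mul_inv, mul_comm, ← enorm_norm (θ - θ₀),
    ← enorm_inv (norm_ne_zero_iff.2 (sub_ne_zero.2 hne)), ← eLpNorm_const_smul]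
  refine congrArg (eLpNorm · 2 μ) (funext fun y => ?_)
  rw [Pi.sub_apply, map_smul, ← smul_sub, Pi.smul_apply]

end QuadraticMean

section ConstantNorm

variable {α : Type*} [MeasurableSpace α] {μ : Measure α}

theorem inner_toLp_toLp {s d : α → ℝ} (hs : MemLp s 2 μ) (hd : MemLp d 2 μ) :
    inner ℝ (hs.toLp s) (hd.toLp d) = ∫ y, s y * d y ∂μ := by
  rw [L2.inner_def]
  refine integral_congr_ae ?_
  filter_upwards [hs.coeFn_toLp, hd.coeFn_toLp] with y hsy hdy
  rw [hsy, hdy, real_inner_comm]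
  rfl

theorem hasDerivAt_toLp_of_tendsto_eLpNorm [DecidablePred fun u : α → ℝ => MemLp u 2 μ]
    {s : ℝ → α → ℝ} {d : α → ℝ}
    (hs : ∀ᶠ t in 𝓝 0, MemLp (s t) 2 μ) (hd : MemLp d 2 μ)
    (hlim : Tendsto (fun t => eLpNorm (s t - s 0 - t • d) 2 μ / ‖t‖ₑ) (𝓝[≠] 0) (𝓝 0)) :
    HasDerivAt (fun t => if h : MemLp (s t) 2 μ then h.toLp (s t) else 0) (hd.toLp d) 0 := by
  have hreal := (ENNReal.tendsto_toReal ENNReal.zero_ne_top).comp hlim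
  refine hasDerivAt_iff_tendsto.2 (Tendsto.mono_left (tendsto_sup.2 ⟨hreal.congr' ?_, ?_⟩)
    (nhdsNE_sup_pure (0 : ℝ)).ge)
  · filter_upwards [nhdsWithin_le_nhds hs] with t ht
    rw [dif_pos ht, dif_pos hs.self_of_nhds, sub_zero, ← MemLp.toLp_sub, ← MemLp.toLp_const_smul,
      ← MemLp.toLp_sub, Lp.norm_toLp, Function.comp_apply, ENNReal.toReal_div, toReal_enorm,
      inv_mul_eq_div]
  · exact tendsto_pure_left.2 fun S hS => by simpa using mem_of_mem_nhds hS

theorem integral_mul_eq_zero_of_eLpNorm_eq {s : ℝ → α → ℝ} {d : α → ℝ}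
    (hs : ∀ᶠ t in 𝓝 0, MemLp (s t) 2 μ) (hd : MemLp d 2 μ)
    (hconst : ∀ᶠ t in 𝓝 0, eLpNorm (s t) 2 μ = eLpNorm (s 0) 2 μ)
    (hlim : Tendsto (fun t => eLpNorm (s t - s 0 - t • d) 2 μ / ‖t‖ₑ) (𝓝[≠] 0) (𝓝 0)) :
    ∫ y, s 0 y * d y ∂μ = 0 := by
  classical
  set F : ℝ → Lp ℝ 2 μ := fun t => if h : MemLp (s t) 2 μ then h.toLp (s t) else 0
  have hF (t : ℝ) (ht : MemLp (s t) 2 μ) : F t = ht.toLp (s t) := dif_pos ht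
  have hs₀ := hs.self_of_nhds
  have hderiv : HasDerivAt F (hd.toLp d) 0 := hasDerivAt_toLp_of_tendsto_eLpNorm hs hd hlim
  have hnorm : (fun t => ‖F t‖ ^ 2) =ᶠ[𝓝 0] fun _ => ‖F 0‖ ^ 2 := by
    filter_upwards [hs, hconst] with t ht hct
    rw [hF t ht, hF 0 hs₀, Lp.norm_toLp, Lp.norm_toLp, hct]
  have hzero : 2 * inner ℝ (F 0) (hd.toLp d) = 0 :=
    hderiv.norm_sq.unique ((hasDerivAt_const 0 _).congr_of_eventuallyEq hnorm)
  rw [← inner_toLp_toLp hs₀ hd, ← hF 0 hs₀]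
  linarith

theorem tendsto_eLpNorm_line_of_tendsto_eLpNorm {E : Type*} [NormedAddCommGroup E]
    [NormedSpace ℝ E] {s : E → α → ℝ} {D : α → E →L[ℝ] ℝ} {θ₀ v : E} (hv : v ≠ 0)
    (hlim : Tendsto (fun θ => eLpNorm (fun y => s θ y - s θ₀ y - D y (θ - θ₀)) 2 μ / ‖θ - θ₀‖ₑ)
      (𝓝[≠] θ₀) (𝓝 0)) :
    Tendsto (fun t : ℝ =>
      eLpNorm (s (θ₀ + t • v) - s (θ₀ + (0 : ℝ) • v) - t • fun y => D y v) 2 μ / ‖t‖ₑ)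
      (𝓝[≠] 0) (𝓝 0) := by
  have hline : Tendsto (fun t : ℝ => θ₀ + t • v) (𝓝[≠] 0) (𝓝[≠] θ₀) := by
    refine tendsto_nhdsWithin_iff.2 ⟨?_, ?_⟩
    · have hcont : Continuous fun t : ℝ => θ₀ + t • v := by fun_prop
      simpa using (hcont.tendsto 0).mono_left nhdsWithin_le_nhds
    · filter_upwards [self_mem_nhdsWithin] with t ht
      simpa [hv] using ht
  have hmul := ENNReal.Tendsto.const_mul (a := ‖v‖ₑ) (hlim.comp hline) (Or.inr enorm_ne_top)
  rw [mul_zero] at hmul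
  refine hmul.congr fun t => ?_
  simp only [Function.comp_apply, add_sub_cancel_left, map_smul, enorm_smul, zero_smul, add_zero]
  rw [← mul_div_assoc, mul_comm, ENNReal.mul_div_mul_right _ _ (enorm_ne_zero.2 hv) enorm_ne_top]
  rfl

theorem integral_mul_eq_zero_of_eLpNorm_eventually_const {E : Type*} [NormedAddCommGroup E]
    [NormedSpace ℝ E] {s : E → α → ℝ} {D : α → E →L[ℝ] ℝ} {θ₀ : E}
    (hs : ∀ᶠ θ in 𝓝 θ₀, MemLp (s θ) 2 μ) (hD : MemLp D 2 μ)
    (hconst : ∀ᶠ θ in 𝓝 θ₀, eLpNorm (s θ) 2 μ = eLpNorm (s θ₀) 2 μ)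
    (hlim : Tendsto (fun θ => eLpNorm (fun y => s θ y - s θ₀ y - D y (θ - θ₀)) 2 μ / ‖θ - θ₀‖ₑ)
      (𝓝[≠] θ₀) (𝓝 0)) (v : E) :
    ∫ y, s θ₀ y * D y v ∂μ = 0 := by
  rcases eq_or_ne v 0 with rfl | hv
  · simp only [map_zero, mul_zero, integral_zero]
  have hline : Tendsto (fun t : ℝ => θ₀ + t • v) (𝓝 0) (𝓝 θ₀) := by
    have hcont : Continuous fun t : ℝ => θ₀ + t • v := by fun_prop
    simpa using hcont.tendsto 0
  have hzero := integral_mul_eq_zero_of_eLpNorm_eq (s := fun t => s (θ₀ + t • v))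
    (hline.eventually hs) ((ContinuousLinearMap.apply ℝ ℝ v).comp_memLp' hD)
    (by simpa using hline.eventually hconst) (tendsto_eLpNorm_line_of_tendsto_eLpNorm hv hlim)
  simpa using hzero

end ConstantNorm

section DensityMeasure

variable {p : ℝ → ℝ} {F : Type*} [NormedAddCommGroup F] [NormedSpace ℝ F]

theorem IsDensity.integrable (hp : IsDensity p) : Integrable p := by
  refine ⟨hp.measurable.aestronglyMeasurable, ?_⟩
  rw [hasFiniteIntegral_iff_ofReal (ae_of_all _ hp.nonneg), hp.lintegral_eq_one]
  exact ENNReal.one_lt_top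

theorem IsDensity.isProbabilityMeasure (hp : IsDensity p) :
    IsProbabilityMeasure (densityMeasure p) :=
  ⟨by rw [densityMeasure, withDensity_apply _ MeasurableSet.univ, setLIntegral_univ,
    hp.lintegral_eq_one]⟩

theorem integral_densityMeasure (hp : Measurable p) (hnonneg : ∀ y, 0 ≤ p y) (g : ℝ → F) :
    ∫ y, g y ∂(densityMeasure p) = ∫ y, p y • g y := by
  rw [densityMeasure, integral_withDensity_eq_integral_toReal_smul hp.ennreal_ofReal
    (ae_of_all _ fun _ => ENNReal.ofReal_lt_top)]
  simp only [ENNReal.toReal_ofReal (hnonneg _)]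

theorem eLpNorm_sqrt_smul_two (hp : Measurable p) (hnonneg : ∀ y, 0 ≤ p y) (g : ℝ → F) :
    eLpNorm (fun y => √(p y) • g y) 2 volume = eLpNorm g 2 (densityMeasure p) := by
  have hsq (y : ℝ) : ‖√(p y) • g y‖ₑ ^ 2 = ENNReal.ofReal (p y) * ‖g y‖ₑ ^ 2 := by
    rw [enorm_smul, mul_pow, Real.enorm_of_nonneg (Real.sqrt_nonneg _),
      ← ENNReal.ofReal_pow (Real.sqrt_nonneg _), Real.sq_sqrt (hnonneg y)]
  refine (ENNReal.pow_right_strictMono two_ne_zero).injective ?_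
  simp only [sq_eLpNorm_two_eq_lintegral, hsq, densityMeasure]
  exact (lintegral_withDensity_eq_lintegral_mul_non_measurable _ hp.ennreal_ofReal
    (ae_of_all _ fun _ => ENNReal.ofReal_lt_top) _).symm

theorem aestronglyMeasurable_sqrt_smul (hp : Measurable p) (hnonneg : ∀ y, 0 ≤ p y) {g : ℝ → F}
    (hg : AEStronglyMeasurable g (densityMeasure p)) :
    AEStronglyMeasurable (fun y => √(p y) • g y) volume := by
  have hsmul : AEStronglyMeasurable (fun y => p y • g y) volume := by
    simpa only [Real.coe_toNNReal _ (hnonneg _)] using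
      (aestronglyMeasurable_withDensity_iff hp.real_toNNReal).1 hg
  refine (hp.sqrt.inv.aestronglyMeasurable.smul hsmul).congr (ae_of_all _ fun y => ?_)
  simp only [smul_smul, Pi.smul_apply', Pi.inv_apply]
  rw [inv_mul_eq_div, Real.div_sqrt]

theorem memLp_two_sqrt_smul (hp : Measurable p) (hnonneg : ∀ y, 0 ≤ p y) {g : ℝ → F}
    (hg : MemLp g 2 (densityMeasure p)) : MemLp (fun y => √(p y) • g y) 2 volume :=
  ⟨aestronglyMeasurable_sqrt_smul hp hnonneg hg.1,
    (eLpNorm_sqrt_smul_two hp hnonneg g).trans_lt hg.2⟩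

theorem IsDensity.eLpNorm_sqrt (hp : IsDensity p) : eLpNorm (fun y => √(p y)) 2 volume = 1 := by
  have := hp.isProbabilityMeasure
  simpa [eLpNorm_const' (1 : ℝ) two_ne_zero ENNReal.ofNat_ne_top] using
    eLpNorm_sqrt_smul_two hp.measurable hp.nonneg fun _ => (1 : ℝ)

theorem IsDensity.memLp_sqrt (hp : IsDensity p) : MemLp (fun y => √(p y)) 2 volume :=
  ⟨hp.measurable.sqrt.aestronglyMeasurable, hp.eLpNorm_sqrt.trans_lt ENNReal.one_lt_top⟩

end DensityMeasure

section Convolution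

variable {k : ℕ} {f : EuclideanSpace ℝ (Fin k) → ℝ → ℝ} {h : ℝ → ℝ}
  {θ : EuclideanSpace ℝ (Fin k)}

theorem q_nonneg (hf : ∀ s, 0 ≤ f θ s) (hh : ∀ s, 0 ≤ h s) (y : ℝ) : 0 ≤ q f h y θ :=
  integral_nonneg fun s => mul_nonneg (hf s) (hh _)

theorem measurable_q (hf : Measurable (f θ)) (hh : Measurable h) :
    Measurable fun y => q f h y θ := by
  refine (StronglyMeasurable.integral_prod_right
    (f := fun (y s : ℝ) => f θ s * h (y - s)) ?_).measurable
  exact ((hf.comp measurable_snd).mul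
    (hh.comp (measurable_fst.sub measurable_snd))).stronglyMeasurable

theorem ofReal_q_ae_eq_lconvolution (hf : IsDensity (f θ)) (hh : IsDensity h) :
    (fun y => ENNReal.ofReal (q f h y θ)) =ᵐ[volume]
      lconvolution (fun s => ENNReal.ofReal (f θ s)) (fun s => ENNReal.ofReal (h s)) volume := by
  filter_upwards [hf.integrable.ae_convolution_exists (ContinuousLinearMap.mul ℝ ℝ) hh.integrable]
    with y hy
  have hint : Integrable fun s => f θ s * h (y - s) := hy
  rw [q, ofReal_integral_eq_lintegral_ofReal hint
    (ae_of_all _ fun s => mul_nonneg (hf.nonneg s) (hh.nonneg _)), lconvolution]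
  refine lintegral_congr fun s => ?_
  rw [ENNReal.ofReal_mul (hf.nonneg s), neg_add_eq_sub]

theorem Q_eq_conv (hf : IsDensity (f θ)) (hh : IsDensity h) :
    Q f h θ = (densityMeasure (f θ)).conv (densityMeasure h) := by
  rw [densityMeasure, densityMeasure, conv_withDensity_eq_lconvolution
    hf.measurable.ennreal_ofReal hh.measurable.ennreal_ofReal]
  exact withDensity_congr_ae (ofReal_q_ae_eq_lconvolution hf hh)

theorem isProbabilityMeasure_Q (hf : IsDensity (f θ)) (hh : IsDensity h) :
    IsProbabilityMeasure (Q f h θ) := by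
  have := hf.isProbabilityMeasure
  have := hh.isProbabilityMeasure
  rw [Q_eq_conv hf hh]
  infer_instance

theorem isDensity_q (hf : IsDensity (f θ)) (hh : IsDensity h) :
    IsDensity fun y => q f h y θ where
  measurable := measurable_q hf.measurable hh.measurable
  nonneg := q_nonneg hf.nonneg hh.nonneg
  lintegral_eq_one := by
    have := (isProbabilityMeasure_Q hf hh).measure_univ
    rwa [Q, densityMeasure, withDensity_apply _ MeasurableSet.univ, setLIntegral_univ] at this

end Convolution

section Sample

variable {Ω : Type*} [MeasurableSpace Ω] {P : Measure Ω} {h : ℝ → ℝ} {X ε : ℕ → Ω → ℝ}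

theorem IsSample.hasLaw_add {k : ℕ} {f : EuclideanSpace ℝ (Fin k) → ℝ → ℝ}
    {θ : EuclideanSpace ℝ (Fin k)} (hs : IsSample P (f θ) h X ε) (hf : IsDensity (f θ))
    (hh : IsDensity h) (j : ℕ) : HasLaw (fun ω => X j ω + ε j ω) (Q f h θ) P where
  aemeasurable := (hs.law_signal j).aemeasurable.add (hs.law_noise j).aemeasurable
  map_eq := by
    have := hf.isProbabilityMeasure
    have : IsProbabilityMeasure P := (hs.law_signal j).isProbabilityMeasure
    rw [Q_eq_conv hf hh, ← (hs.law_signal j).map_eq, ← (hs.law_noise j).map_eq]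
    exact (hs.indep_signal_noise j).map_add_eq_map_conv_map₀ (hs.law_signal j).aemeasurable
      (hs.law_noise j).aemeasurable

theorem IsSample.iIndepFun_add {f₀ : ℝ → ℝ} (hs : IsSample P f₀ h X ε) :
    iIndepFun (fun j ω => X j ω + ε j ω) P :=
  hs.indep.comp (fun _ z => z.1 + z.2) fun _ => measurable_fst.add measurable_snd

end Sample

section SecondMoment

open Matrix

variable {α ι : Type*} [MeasurableSpace α] {μ : Measure α}

/-- The second moment matrix `∫ g gᵀ dμ` of a vector-valued function. The Fisher information at `θ`
is the second moment matrix of the score under `Q_θ`. -/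
noncomputable def secondMoment (μ : Measure α) (g : α → EuclideanSpace ℝ ι) : Matrix ι ι ℝ :=
  Matrix.of fun i j => ∫ y, g y i * g y j ∂μ

theorem secondMoment_comp_of_hasLaw {Ω : Type*} [MeasurableSpace Ω] {P : Measure Ω} {Y : Ω → α}
    (hY : HasLaw Y μ P) {g : α → EuclideanSpace ℝ ι} (hg : AEStronglyMeasurable g μ) :
    secondMoment P (fun ω => g (Y ω)) = secondMoment μ g := by
  have hcoord (i : ι) : AEStronglyMeasurable (fun y => g y i) μ :=
    (EuclideanSpace.proj (𝕜 := ℝ) i).continuous.comp_aestronglyMeasurable hg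
  ext i j
  exact hY.integral_comp ((hcoord i).mul (hcoord j))

variable [Fintype ι]

theorem dotProduct_secondMoment_mulVec {g : α → EuclideanSpace ℝ ι} (hg : MemLp g 2 μ)
    (v : EuclideanSpace ℝ ι) :
    v.ofLp ⬝ᵥ secondMoment μ g *ᵥ v.ofLp = ∫ y, inner ℝ v (g y) ^ 2 ∂μ := by
  have hcoord (i : ι) : MemLp (fun y => g y i) 2 μ :=
    (EuclideanSpace.proj (𝕜 := ℝ) i).comp_memLp' hg
  have hint (i j : ι) : Integrable (fun y => v i * (g y i * g y j * v j)) μ :=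
    (((hcoord i).integrable_mul (hcoord j)).mul_const _).const_mul _
  have hexpand (y : α) : inner ℝ v (g y) ^ 2 = ∑ i, ∑ j, v i * (g y i * g y j * v j) := by
    rw [PiLp.inner_apply, sq, Finset.sum_mul_sum]
    refine Finset.sum_congr rfl fun i _ => Finset.sum_congr rfl fun j _ => ?_
    simp only [RCLike.inner_apply, conj_trivial]
    ring
  simp only [hexpand, dotProduct, mulVec, secondMoment, of_apply, Finset.mul_sum]
  rw [integral_finsetSum _ fun i _ => integrable_finsetSum _ fun j _ => hint i j]
  simp only [integral_finsetSum _ fun j _ => hint _ j, integral_const_mul, integral_mul_const]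

theorem posSemidef_secondMoment {g : α → EuclideanSpace ℝ ι} (hg : MemLp g 2 μ) :
    (secondMoment μ g).PosSemidef := by
  refine PosSemidef.of_dotProduct_mulVec_nonneg ?_ fun v => ?_
  · ext i j
    simp [secondMoment, mul_comm]
  · rw [star_trivial]
    exact (integral_nonneg fun y => sq_nonneg _).trans_eq
      (dotProduct_secondMoment_mulVec hg (WithLp.toLp 2 v)).symm

theorem eventually_dotProduct_mulVec_le {X : Type*} [TopologicalSpace X]
    {A : X → Matrix ι ι ℝ} {x₀ : X} (hA : ContinuousAt A x₀) {ε : ℝ} (hε : 0 < ε) :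
    ∀ᶠ x in 𝓝 x₀, ∀ v : EuclideanSpace ℝ ι,
      v.ofLp ⬝ᵥ A x *ᵥ v.ofLp ≤ v.ofLp ⬝ᵥ A x₀ *ᵥ v.ofLp + ε * ‖v‖ ^ 2 := by
  classical
  let T : Matrix ι ι ℝ → EuclideanSpace ℝ ι →L[ℝ] EuclideanSpace ℝ ι := toEuclideanCLM (𝕜 := ℝ)
  have hT : Continuous T :=
    (toEuclideanCLM (n := ι) (𝕜 := ℝ)).toAlgEquiv.toLinearMap.continuous_of_finiteDimensional
  have hclose := Metric.continuousAt_iff'.1 (hT.continuousAt.comp hA) ε hε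
  filter_upwards [hclose] with x hx v
  have hinner (B : Matrix ι ι ℝ) : v.ofLp ⬝ᵥ B *ᵥ v.ofLp = inner ℝ v (T B v) :=
    (inner_toEuclideanCLM B v v).symm
  rw [dist_eq_norm] at hx
  have hle : inner ℝ v ((T (A x) - T (A x₀)) v) ≤ ε * ‖v‖ ^ 2 := calc
    inner ℝ v ((T (A x) - T (A x₀)) v) ≤ ‖v‖ * (‖T (A x) - T (A x₀)‖ * ‖v‖) :=
      (real_inner_le_norm _ _).trans (by gcongr; exact ContinuousLinearMap.le_opNorm _ _)
    _ = ‖T (A x) - T (A x₀)‖ * ‖v‖ ^ 2 := by ring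
    _ ≤ ε * ‖v‖ ^ 2 := by gcongr; exact hx.le
  rw [_root_.sub_apply, inner_sub_right] at hle
  rw [hinner, hinner]
  linarith

end SecondMoment

section CentralLimit

open Matrix

variable {E Ω Ω' : Type*} [NormedAddCommGroup E] [InnerProductSpace ℝ E]
  [MeasurableSpace E] [BorelSpace E] [MeasurableSpace Ω] {P : Measure Ω} [MeasurableSpace Ω']
  {P' : Measure Ω'}

theorem charFun_map_inner_one {X : Ω → E} (hX : AEMeasurable X P) (t : E) :
    charFun (P.map fun ω => inner ℝ t (X ω)) 1 = charFun (P.map X) t := by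
  have hcomp : (P.map X).map (fun x => inner ℝ t x) = P.map fun ω => inner ℝ t (X ω) :=
    AEMeasurable.map_map_of_aemeasurable (by fun_prop) hX
  rw [charFun_eq_charFunDual_toDualMap (μ := P.map X), charFunDual_eq_charFun_map_one, ← hcomp]
  rfl

theorem tendstoInDistribution_of_forall_inner [FiniteDimensional ℝ E] [IsProbabilityMeasure P]
    [IsProbabilityMeasure P'] {X : ℕ → Ω → E} {Z : Ω' → E}
    (hX : ∀ n, AEMeasurable (X n) P) (hZ : AEMeasurable Z P')
    (hinner : ∀ t : E, TendstoInDistribution (fun n ω => inner ℝ t (X n ω)) atTop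
      (fun ω => inner ℝ t (Z ω)) (fun _ => P) P') :
    TendstoInDistribution X atTop Z (fun _ => P) P' := by
  refine ⟨hX, hZ, ProbabilityMeasure.tendsto_iff_tendsto_charFun.2 fun t => ?_⟩
  have hlim := ProbabilityMeasure.tendsto_iff_tendsto_charFun.1 (hinner t).tendsto 1
  simpa only [ProbabilityMeasure.coe_mk, charFun_map_inner_one (hX _),
    charFun_map_inner_one hZ] using hlim

theorem hasLaw_inner_multivariateGaussian {ι : Type*} [Fintype ι] [DecidableEq ι]
    {S : Matrix ι ι ℝ} (hS : S.PosSemidef) (t : EuclideanSpace ℝ ι) :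
    HasLaw (fun x => inner ℝ t x) (gaussianReal 0 (t.ofLp ⬝ᵥ S *ᵥ t.ofLp).toNNReal)
      (multivariateGaussian 0 S) where
  map_eq := by
    have hmean : ∫ x, innerSL ℝ t x ∂(multivariateGaussian 0 S) = 0 := by
      rw [(innerSL ℝ t).integral_comp_id_comm IsGaussian.integrable_id,
        integral_id_multivariateGaussian, map_zero]
    have hvar : Var[innerSL ℝ t; multivariateGaussian 0 S] = t.ofLp ⬝ᵥ S *ᵥ t.ofLp := by
      rw [← covarianceBilin_multivariateGaussian hS, covarianceBilin_self IsGaussian.memLp_two_id]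
      rfl
    have hmap := IsGaussian.map_eq_gaussianReal (μ := multivariateGaussian 0 S) (innerSL ℝ t)
    rwa [hmean, hvar] at hmap

theorem tendstoInDistribution_inv_sqrt_smul_sum_multivariateGaussian {ι : Type*}
    [Fintype ι] [DecidableEq ι] [IsProbabilityMeasure P]
    {ξ : ℕ → Ω → EuclideanSpace ℝ ι} (hindep : iIndepFun ξ P)
    (hident : ∀ j, IdentDistrib (ξ j) (ξ 0) P P) (hmemLp : MemLp (ξ 0) 2 P)
    (hmean : ∀ t, ∫ ω, inner ℝ t (ξ 0 ω) ∂P = 0) :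
    TendstoInDistribution (fun (n : ℕ) ω => (√(n : ℝ))⁻¹ • ∑ j ∈ Finset.range n, ξ j ω) atTop
      (id : EuclideanSpace ℝ ι → EuclideanSpace ℝ ι) (fun _ => P)
      (multivariateGaussian 0 (secondMoment P (ξ 0))) := by
  have hξ (j : ℕ) : AEMeasurable (ξ j) P := (hident j).aemeasurable_fst
  refine tendstoInDistribution_of_forall_inner
    (fun n => (Finset.aemeasurable_fun_sum _ fun j _ => hξ j).fun_const_smul _)
    aemeasurable_id fun t => ?_
  have hinner : Measurable fun x : EuclideanSpace ℝ ι => inner ℝ t x := by fun_prop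
  have hvar : Var[fun ω => inner ℝ t (ξ 0 ω); P] =
      t.ofLp ⬝ᵥ secondMoment P (ξ 0) *ᵥ t.ofLp := by
    rw [dotProduct_secondMoment_mulVec hmemLp]
    exact variance_of_integral_eq_zero (hinner.comp_aemeasurable (hξ 0)) (hmean t)
  have hclt := tendstoInDistribution_inv_sqrt_mul_sum_sub (X := fun j ω => inner ℝ t (ξ j ω))
    (Y := fun x => inner ℝ t (id x))
    (hvar ▸ hasLaw_inner_multivariateGaussian (posSemidef_secondMoment hmemLp) t)
    (hmemLp.const_inner t) (hindep.comp (fun _ x => inner ℝ t x) fun _ => hinner)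
    fun j => (hident j).comp hinner
  simpa only [hmean, mul_zero, sub_zero, inner_smul_right, inner_sum] using hclt

open scoped MatrixOrder Matrix.Norms.L2Operator in
theorem map_dotProduct_inv_mulVec_multivariateGaussian {k : ℕ} {S : Matrix (Fin k) (Fin k) ℝ}
    (hS : S.PosDef) :
    (multivariateGaussian 0 S).map (fun x => x.ofLp ⬝ᵥ S⁻¹ *ᵥ x.ofLp) = chiSquare k := by
  let R := CFC.sqrt S
  have hRR : R * R = S := CFC.sqrt_mul_sqrt_self S hS.posSemidef.nonneg
  have hRT : Rᵀ = R := by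
    simpa only [conjTranspose_eq_transpose_of_trivial] using
      (nonneg_iff_posSemidef.1 (CFC.sqrt_nonneg S)).isHermitian.eq
  have hone : R * S⁻¹ * R = 1 := by
    rw [Matrix.mul_assoc, mul_eq_one_comm, Matrix.mul_assoc, hRR]
    exact nonsing_inv_mul _ ((isUnit_iff_isUnit_det _).1 hS.isUnit)
  rw [multivariateGaussian, ← map_pi_eq_stdGaussian, Measure.map_map (by fun_prop) (by fun_prop),
    Measure.map_map (by fun_prop) (by fun_prop), chiSquare]
  congr 1
  ext z
  have hquad : (R *ᵥ z) ⬝ᵥ S⁻¹ *ᵥ (R *ᵥ z) = z ⬝ᵥ z := by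
    rw [← vecMul_transpose, hRT, ← dotProduct_mulVec, ← mulVec_transpose, hRT,
      mulVec_mulVec, mulVec_mulVec, hone, one_mulVec]
  simpa only [Function.comp_apply, zero_add, ofLp_toEuclideanCLM, dotProduct, ← sq] using hquad

theorem tendstoInDistribution_dotProduct_inv_mulVec [IsProbabilityMeasure P] {k : ℕ}
    {ξ : ℕ → Ω → EuclideanSpace ℝ (Fin k)} (hindep : iIndepFun ξ P)
    (hident : ∀ j, IdentDistrib (ξ j) (ξ 0) P P) (hmemLp : MemLp (ξ 0) 2 P)
    (hmean : ∀ t, ∫ ω, inner ℝ t (ξ 0 ω) ∂P = 0) (hposDef : (secondMoment P (ξ 0)).PosDef) :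
    TendstoInDistribution (fun (n : ℕ) ω =>
        ((√(n : ℝ))⁻¹ • ∑ j ∈ Finset.range n, ξ j ω).ofLp ⬝ᵥ
          (secondMoment P (ξ 0))⁻¹ *ᵥ ((√(n : ℝ))⁻¹ • ∑ j ∈ Finset.range n, ξ j ω).ofLp)
      atTop (id : ℝ → ℝ) (fun _ => P) (chiSquare k) := by
  have hquad : Continuous fun x : EuclideanSpace ℝ (Fin k) =>
      x.ofLp ⬝ᵥ (secondMoment P (ξ 0))⁻¹ *ᵥ x.ofLp := by fun_prop
  have hlim := (tendstoInDistribution_inv_sqrt_smul_sum_multivariateGaussian hindep hident hmemLp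
    hmean).continuous_comp hquad
  refine ⟨hlim.forall_aemeasurable, aemeasurable_id, ?_⟩
  convert! hlim.tendsto using 2
  simp only [Function.comp_id, Measure.map_id,
    map_dotProduct_inv_mulVec_multivariateGaussian hposDef]

end CentralLimit

section Score

open Matrix
open scoped ENNReal

variable {k : ℕ} {Θ : Set (EuclideanSpace ℝ (Fin k))} {f : EuclideanSpace ℝ (Fin k) → ℝ → ℝ}
  {h : ℝ → ℝ} {θ : EuclideanSpace ℝ (Fin k)} {y : ℝ}

theorem score_eq_inv_smul (hq : 0 ≤ q f h y θ) :
    score f h y θ = (q f h y θ)⁻¹ • gradient (fun θ' => q f h y θ') θ := by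
  rw [score]
  split_ifs with hpos
  · rfl
  · rw [le_antisymm (not_lt.1 hpos) hq, _root_.inv_zero, zero_smul]

theorem fderiv_sqrt_q (hq : 0 ≤ q f h y θ) (hdiff : DifferentiableAt ℝ (q f h y) θ) :
    fderiv ℝ (fun x => √(q f h y x)) θ =
      innerSL ℝ ((1 / 2 : ℝ) • √(q f h y θ) • score f h y θ) := by
  rw [fderiv_sqrt_eq_smul hdiff, score_eq_inv_smul hq, smul_smul, smul_smul, map_smul]
  have hgradient : innerSL ℝ (gradient (fun θ' => q f h y θ') θ) = fderiv ℝ (q f h y) θ :=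
    (InnerProductSpace.toDual ℝ _).apply_symm_apply _
  rw [hgradient, mul_assoc, ← div_eq_mul_inv, Real.sqrt_div_self', mul_inv, one_div, one_div]

/-- Smoothness part of a regular deconvolution problem: the densities `q(y; ·)` are continuously
differentiable and the score is square integrable, without conditions on the Fisher information. -/
structure IsSmooth (Θ : Set (EuclideanSpace ℝ (Fin k)))
    (f : EuclideanSpace ℝ (Fin k) → ℝ → ℝ) (h : ℝ → ℝ) : Prop where
  isOpen : IsOpen Θ
  density : ∀ θ ∈ Θ, IsDensity (f θ)
  noise : IsDensity h
  contDiff : ∀ᵐ y : ℝ, ContDiffOn ℝ 1 (fun θ => q f h y θ) Θ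
  memLp_score : ∀ θ ∈ Θ, MemLp (fun y => score f h y θ) 2 (Q f h θ)

theorem IsRegular.isSmooth (hreg : IsRegular Θ f h) : IsSmooth Θ f h where
  isOpen := hreg.isOpen
  density := hreg.density
  noise := hreg.noise.isDensity
  contDiff := hreg.contDiff
  memLp_score := hreg.memLp_score

namespace IsSmooth

theorem isDensity_q (hsm : IsSmooth Θ f h) (hθ : θ ∈ Θ) : IsDensity fun y => q f h y θ :=
  Deconvolution.isDensity_q (hsm.density θ hθ) hsm.noise

theorem isC1Family (hsm : IsSmooth Θ f h) : IsC1Family volume Θ (q f h) where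
  isOpen := hsm.isOpen
  measurable _ hθ := (hsm.isDensity_q hθ).measurable
  nonneg y _ hθ := (hsm.isDensity_q hθ).nonneg y
  contDiffOn := hsm.contDiff

theorem ae_fderiv_sqrt_q (hsm : IsSmooth Θ f h) (hθ : θ ∈ Θ) :
    ∀ᵐ y, fderiv ℝ (fun x => √(q f h y x)) θ =
      innerSL ℝ ((1 / 2 : ℝ) • √(q f h y θ) • score f h y θ) := by
  filter_upwards [hsm.isC1Family.ae_differentiableAt hθ] with y hy
  exact fderiv_sqrt_q ((hsm.isDensity_q hθ).nonneg y) hy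

theorem memLp_fderiv_sqrt_q (hsm : IsSmooth Θ f h) (hθ : θ ∈ Θ) :
    MemLp (fun y => fderiv ℝ (fun x => √(q f h y x)) θ) 2 volume := by
  have hsqrt : MemLp (fun y => √(q f h y θ) • score f h y θ) 2 volume :=
    memLp_two_sqrt_smul (hsm.isDensity_q hθ).measurable (hsm.isDensity_q hθ).nonneg
      (hsm.memLp_score θ hθ)
  refine MemLp.ae_eq (EventuallyEq.symm (hsm.ae_fderiv_sqrt_q hθ)) ?_
  exact (innerSL ℝ (E := EuclideanSpace ℝ (Fin k))).comp_memLp' (hsqrt.const_smul (1 / 2 : ℝ))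

theorem lintegral_fderiv_sqrt_q_sq (hsm : IsSmooth Θ f h) (hθ : θ ∈ Θ)
    (v : EuclideanSpace ℝ (Fin k)) :
    ∫⁻ y, ‖fderiv ℝ (fun x => √(q f h y x)) θ v‖ₑ ^ 2 =
      ENNReal.ofReal (v.ofLp ⬝ᵥ fisherInformation f h θ *ᵥ v.ofLp / 4) := by
  have hd := hsm.isDensity_q hθ
  have hscore : MemLp (fun y => (1 / 2 : ℝ) * inner ℝ v (score f h y θ)) 2 (Q f h θ) :=
    ((hsm.memLp_score θ hθ).const_inner v).const_mul (1 / 2)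
  calc ∫⁻ y, ‖fderiv ℝ (fun x => √(q f h y x)) θ v‖ₑ ^ 2
    _ = ∫⁻ y, ‖√(q f h y θ) • ((1 / 2 : ℝ) * inner ℝ v (score f h y θ))‖ₑ ^ 2 := by
      refine lintegral_congr_ae ?_
      filter_upwards [hsm.ae_fderiv_sqrt_q hθ] with y hy
      simp only [hy, innerSL_apply_apply, real_inner_smul_left, smul_eq_mul]
      rw [real_inner_comm, mul_left_comm]
    _ = ∫⁻ y, ‖(1 / 2 : ℝ) * inner ℝ v (score f h y θ)‖ₑ ^ 2 ∂(Q f h θ) := by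
      rw [← sq_eLpNorm_two_eq_lintegral, eLpNorm_sqrt_smul_two hd.measurable hd.nonneg,
        sq_eLpNorm_two_eq_lintegral, Q]
    _ = ENNReal.ofReal (∫ y, ((1 / 2 : ℝ) * inner ℝ v (score f h y θ)) ^ 2 ∂(Q f h θ)) := by
      rw [ofReal_integral_eq_lintegral_ofReal hscore.integrable_sq
        (ae_of_all _ fun _ => sq_nonneg _)]
      refine lintegral_congr fun y => ?_
      rw [← enorm_pow, Real.enorm_of_nonneg (sq_nonneg _)]
    _ = ENNReal.ofReal (v.ofLp ⬝ᵥ fisherInformation f h θ *ᵥ v.ofLp / 4) := by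
      have hI : v.ofLp ⬝ᵥ fisherInformation f h θ *ᵥ v.ofLp =
          ∫ y, inner ℝ v (score f h y θ) ^ 2 ∂(Q f h θ) :=
        dotProduct_secondMoment_mulVec (hsm.memLp_score θ hθ) v
      simp only [mul_pow, integral_const_mul, hI]
      congr 1
      ring

theorem eventually_lintegral_fderiv_sqrt_q_sq_le (hsm : IsSmooth Θ f h) (hθ : θ ∈ Θ)
    (hI : ContinuousAt (fisherInformation f h) θ) {ε : ℝ≥0∞} (hε : 0 < ε) :
    ∀ᶠ θ' in 𝓝 θ, ∀ v, ∫⁻ y, ‖fderiv ℝ (fun x => √(q f h y x)) θ' v‖ₑ ^ 2 ≤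
      (∫⁻ y, ‖fderiv ℝ (fun x => √(q f h y x)) θ v‖ₑ ^ 2) + ε * ‖v‖ₑ ^ 2 := by
  obtain ⟨δ, hδ, hδε⟩ := ENNReal.lt_iff_exists_nnreal_btwn.1 hε
  have hδ' : (0 : ℝ) < δ := by exact_mod_cast hδ
  filter_upwards [hsm.isOpen.mem_nhds hθ,
    eventually_dotProduct_mulVec_le hI (ε := 4 * δ) (by positivity)] with θ' hθ' hle v
  have hnonneg : 0 ≤ v.ofLp ⬝ᵥ fisherInformation f h θ *ᵥ v.ofLp := by
    have := (posSemidef_secondMoment (hsm.memLp_score θ hθ)).dotProduct_mulVec_nonneg v.ofLp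
    rwa [star_trivial] at this
  calc ∫⁻ y, ‖fderiv ℝ (fun x => √(q f h y x)) θ' v‖ₑ ^ 2
    _ = ENNReal.ofReal (v.ofLp ⬝ᵥ fisherInformation f h θ' *ᵥ v.ofLp / 4) :=
      hsm.lintegral_fderiv_sqrt_q_sq hθ' v
    _ ≤ ENNReal.ofReal (v.ofLp ⬝ᵥ fisherInformation f h θ *ᵥ v.ofLp / 4 + δ * ‖v‖ ^ 2) :=
      ENNReal.ofReal_le_ofReal (by linarith [hle v])
    _ = (∫⁻ y, ‖fderiv ℝ (fun x => √(q f h y x)) θ v‖ₑ ^ 2) + δ * ‖v‖ₑ ^ 2 := by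
      rw [hsm.lintegral_fderiv_sqrt_q_sq hθ, ENNReal.ofReal_add (by positivity) (by positivity),
        ENNReal.ofReal_mul δ.coe_nonneg, ENNReal.ofReal_coe_nnreal,
        ENNReal.ofReal_pow (norm_nonneg v), ofReal_norm]
    _ ≤ _ := by gcongr

theorem tendsto_eLpNorm_sqrt_q (hsm : IsSmooth Θ f h) (hθ : θ ∈ Θ)
    (hI : ContinuousAt (fisherInformation f h) θ) :
    Tendsto (fun θ' => eLpNorm (fun y => √(q f h y θ') - √(q f h y θ) -
      fderiv ℝ (fun x => √(q f h y x)) θ (θ' - θ)) 2 volume / ‖θ' - θ‖ₑ) (𝓝[≠] θ) (𝓝 0) :=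
  hsm.isC1Family.tendsto_eLpNorm_sqrt_sub_sub_fderiv hθ (hsm.memLp_fderiv_sqrt_q hθ)
    fun _ hε => hsm.eventually_lintegral_fderiv_sqrt_q_sq_le hθ hI hε

theorem isQuadraticMeanScore (hsm : IsSmooth Θ f h) (hθ : θ ∈ Θ)
    (hI : ContinuousAt (fisherInformation f h) θ) :
    IsQuadraticMeanScore f h θ (fun y => score f h y θ) := by
  refine ⟨hsm.memLp_score θ hθ, (hsm.tendsto_eLpNorm_sqrt_q hθ hI).congr fun θ' => ?_⟩
  congr 1
  refine eLpNorm_congr_ae ?_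
  filter_upwards [hsm.ae_fderiv_sqrt_q hθ] with y hy
  simp only [hy, innerSL_apply_apply, real_inner_smul_left]
  rw [real_inner_comm]
  ring

theorem integral_inner_score (hsm : IsSmooth Θ f h) (hθ : θ ∈ Θ)
    (hI : ContinuousAt (fisherInformation f h) θ) (v : EuclideanSpace ℝ (Fin k)) :
    ∫ y, inner ℝ v (score f h y θ) ∂(Q f h θ) = 0 := by
  have hd := hsm.isDensity_q hθ
  have hmem : ∀ᶠ θ' in 𝓝 θ, θ' ∈ Θ := hsm.isOpen.mem_nhds hθ
  have horth := integral_mul_eq_zero_of_eLpNorm_eventually_const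
    (hmem.mono fun θ' hθ' => (hsm.isDensity_q hθ').memLp_sqrt) (hsm.memLp_fderiv_sqrt_q hθ)
    (hmem.mono fun θ' hθ' => (hsm.isDensity_q hθ').eLpNorm_sqrt.trans hd.eLpNorm_sqrt.symm)
    (hsm.tendsto_eLpNorm_sqrt_q hθ hI) v
  have hhalf : ∫ y, √(q f h y θ) * fderiv ℝ (fun x => √(q f h y x)) θ v =
      1 / 2 * ∫ y, inner ℝ v (score f h y θ) ∂(Q f h θ) := by
    rw [Q, integral_densityMeasure hd.measurable hd.nonneg, ← integral_const_mul]
    refine integral_congr_ae ?_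
    filter_upwards [hsm.ae_fderiv_sqrt_q hθ] with y hy
    simp only [hy, innerSL_apply_apply, real_inner_smul_left, smul_eq_mul]
    rw [real_inner_comm]
    linear_combination
      (1 / 2 * inner ℝ v (score f h y θ)) * Real.mul_self_sqrt (hd.nonneg y)
  linarith

end IsSmooth

end Score

section ScoreTest

open Matrix

variable {k : ℕ} {Θ : Set (EuclideanSpace ℝ (Fin k))} {f : EuclideanSpace ℝ (Fin k) → ℝ → ℝ}
  {h : ℝ → ℝ}

theorem U_eq_dotProduct_mulVec (n : ℕ) (Y : ℕ → ℝ) :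
    U f h n Y = (scoreSum f h n Y).ofLp ⬝ᵥ
      (fisherInformation f h 0)⁻¹ *ᵥ (scoreSum f h n Y).ofLp := by
  have hL : L f h = (fisherInformation f h 0)⁻¹ := rfl
  simp only [U, hL, dotProduct, mulVec, Finset.mul_sum, mul_assoc]

theorem IsSmooth.tendstoInDistribution_U (hsm : IsSmooth Θ f h)
    (h0 : (0 : EuclideanSpace ℝ (Fin k)) ∈ Θ) (hI : IsUnit (fisherInformation f h 0))
    (hIc : ContinuousAt (fisherInformation f h) 0) {Ω : Type*} [MeasurableSpace Ω]
    {P : Measure Ω} [IsProbabilityMeasure P] {X ε : ℕ → Ω → ℝ} (hs : IsSample P (f 0) h X ε) :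
    TendstoInDistribution (fun (n : ℕ) (ω : Ω) => U f h n (fun j => X j ω + ε j ω))
      atTop (id : ℝ → ℝ) (fun _ => P) (chiSquare k) := by
  let ξ : ℕ → Ω → EuclideanSpace ℝ (Fin k) := fun j ω => efficientScore f h (X j ω + ε j ω)
  have hlaw := hs.hasLaw_add (hsm.density 0 h0) hsm.noise
  have hscore : MemLp (efficientScore f h) 2 (Q f h 0) := hsm.memLp_score 0 h0
  have hmeas (j : ℕ) : AEMeasurable (efficientScore f h) (P.map fun ω => X j ω + ε j ω) := by
    rw [(hlaw j).map_eq]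
    exact hscore.1.aemeasurable
  have hindep : iIndepFun ξ P := hs.iIndepFun_add.comp₀ (fun _ => efficientScore f h)
    (fun j => (hlaw j).aemeasurable) hmeas
  have hident (j : ℕ) : IdentDistrib (ξ j) (ξ 0) P P :=
    ((hlaw j).identDistrib (hlaw 0)).comp_of_aemeasurable (hmeas j)
  have hmemLp : MemLp (ξ 0) 2 P :=
    MemLp.comp_of_map (g := efficientScore f h) (by rwa [(hlaw 0).map_eq]) (hlaw 0).aemeasurable
  have hmean (t : EuclideanSpace ℝ (Fin k)) : ∫ ω, inner ℝ t (ξ 0 ω) ∂P = 0 :=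
    ((hlaw 0).integral_comp (hscore.const_inner t).1).trans (hsm.integral_inner_score h0 hIc t)
  have hmoment : secondMoment P (ξ 0) = fisherInformation f h 0 :=
    secondMoment_comp_of_hasLaw (hlaw 0) hscore.1
  have hposDef : (fisherInformation f h 0).PosDef :=
    (posSemidef_secondMoment hscore).posDef_iff_isUnit.2 hI
  have hlim := tendstoInDistribution_dotProduct_inv_mulVec hindep hident hmemLp hmean
    (hmoment ▸ hposDef)
  simp only [U_eq_dotProduct_mulVec, scoreSum, one_div, ← hmoment]
  exact hlim

end ScoreTest

end Deconvolution

theorem mainTheorem3_general {k : ℕ} (Θ : Set (EuclideanSpace ℝ (Fin k)))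
    (f : EuclideanSpace ℝ (Fin k) → ℝ → ℝ) (h : ℝ → ℝ)
    (hsm : Deconvolution.IsSmooth Θ f h) (h0 : (0 : EuclideanSpace ℝ (Fin k)) ∈ Θ)
    (hI : IsUnit (Deconvolution.fisherInformation f h 0))
    (hIc : ContinuousAt (Deconvolution.fisherInformation f h) 0) :
    ((∀ᵐ y : ℝ, DifferentiableAt ℝ
        (fun θ : EuclideanSpace ℝ (Fin k) => ∫ s, f θ s * h (y - s)) 0) ∧
      (∀ y : ℝ, Deconvolution.efficientScore f h y =
        (∫ s, f 0 s * h (y - s))⁻¹ •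
          gradient (fun θ : EuclideanSpace ℝ (Fin k) => ∫ s, f θ s * h (y - s)) 0) ∧
      Deconvolution.IsQuadraticMeanScore f h 0 (Deconvolution.efficientScore f h)) ∧
    ∀ {Ω : Type*} [MeasurableSpace Ω] (P : Measure Ω) [IsProbabilityMeasure P]
      (X ε : ℕ → Ω → ℝ), Deconvolution.IsSample P (f 0) h X ε →
      TendstoInDistribution
        (fun (n : ℕ) (ω : Ω) => Deconvolution.U f h n (fun j => X j ω + ε j ω))
        atTop (id : ℝ → ℝ) (fun _ => P) (Deconvolution.chiSquare k) := by
  refine ⟨⟨hsm.isC1Family.ae_differentiableAt h0, fun y => ?_, hsm.isQuadraticMeanScore h0 hIc⟩,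
    fun P _ X ε hs => hsm.tendstoInDistribution_U h0 hI hIc hs⟩
  exact Deconvolution.score_eq_inv_smul ((hsm.isDensity_q h0).nonneg y)

theorem mainTheorem3 {k : ℕ} (Θ : Set (EuclideanSpace ℝ (Fin k)))
    (f : EuclideanSpace ℝ (Fin k) → ℝ → ℝ) (h : ℝ → ℝ)
    (hreg : Deconvolution.IsRegular Θ f h) (h0 : (0 : EuclideanSpace ℝ (Fin k)) ∈ Θ) :
    ((∀ᵐ y : ℝ, DifferentiableAt ℝ
        (fun θ : EuclideanSpace ℝ (Fin k) => ∫ s, f θ s * h (y - s)) 0) ∧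
      (∀ y : ℝ, Deconvolution.efficientScore f h y =
        (∫ s, f 0 s * h (y - s))⁻¹ •
          gradient (fun θ : EuclideanSpace ℝ (Fin k) => ∫ s, f θ s * h (y - s)) 0) ∧
      Deconvolution.IsQuadraticMeanScore f h 0 (Deconvolution.efficientScore f h)) ∧
    ∀ {Ω : Type*} [MeasurableSpace Ω] (P : Measure Ω) [IsProbabilityMeasure P]
      (X ε : ℕ → Ω → ℝ), Deconvolution.IsSample P (f 0) h X ε →
      TendstoInDistribution
        (fun (n : ℕ) (ω : Ω) => Deconvolution.U f h n (fun j => X j ω + ε j ω))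
        atTop (id : ℝ → ℝ) (fun _ => P) (Deconvolution.chiSquare k) := by
  exact mainTheorem3_general Θ f h hreg.isSmooth h0 (hreg.nonsingular 0 h0)
    (hreg.continuous_information.continuousAt (hreg.isOpen.mem_nhds h0))
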